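/- For $k\in[0,1]$ let $F(\varphi,k)=\int_0^\varphi(1-k^2\sin^2\theta)^{-1/2}\,d\theta$, let $\operatorname{am}(\cdot,k)$ be the inverse function of $F(\cdot,k)$ (with $F(\cdot,k)$ defined on $\mathbb R$ if $k<1$ and on $(-\pi/2,\pi/2)$ if $k=1$), and let $\operatorname{sn}(x,k)=\sin\operatorname{am}(x,k)$, $\operatorname{cn}(x,k)=\cos\operatorname{am}(x,k)$ and $\operatorname{dn}(x,k)=(1-k^2\operatorname{sn}^2(x,k))^{1/2}$ be the Jacobi elliptic functions. A smooth map $f:\mathbb R^2\to S^5\subset\mathbb C^3$ is *harmonic* if its tension field $\operatorname{tr}\nabla df$ vanishes, for the flat metric on $\mathbb R^2$ and the round metric on the unit sphere $S^5$ of $\mathbb C^3$; it is *weakly conformal* if the induced metric is, at every point, a nonnegative multiple of the flat metric, and *conformal* at a point if this multiple is positive there. **Theorem 6.6.** Let $\epsilon>0$ and let $w_1,w_2,w_3:(-\epsilon,\epsilon)\to\mathbb C\setminus\{0\}$ satisfy $$\frac{dw_1}{dt}=\overline{w_2w_3},\qquad \frac{dw_2}{dt}=-\,\overline{w_3w_1},\qquad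 \frac{dw_3}{dt}=-\,\overline{w_1w_2}.$$ Let $\alpha_1,\alpha_2,\alpha_3\in\mathbb R$ and $u:(-\epsilon,\epsilon)\to\mathbb R$ be such that $|w_1|^2=\alpha_1+u$, $|w_2|^2=\alpha_2-u$ and $|w_3|^2=\alpha_3-u$, and suppose that $\alpha_2\le\alpha_3$. Then $w_1,w_2,w_3$ extend to solutions $w_1,w_2,w_3:\mathbb R\to\mathbb C$ of the same equations. For any such extension put $\mu=(\alpha_1+\alpha_3)^{1/2}$ and $\nu=\left(\frac{\alpha_3-\alpha_2}{\alpha_1+\alpha_3}\right)^{1/2}$ and define, for $(s,t)\in\mathbb R^2$, $$\Phi(s,t)=\Bigl((\alpha_1+\alpha_2)^{-1/2}\operatorname{dn}(\mu s,\nu)\,w_1(t),\ (\alpha_1+\alpha_2)^{-1/2}\operatorname{cn}(\mu s,\nu)\,w_2(t),\ (\alpha_1+\alpha_3)^{-1/2}\operatorname{sn}(\mu s,\nu)\,w_3(t)\Bigr).$$ Then $\Phi$ takes values in $S^5$ and is a harmonic, weakly conformal map $\mathbb R^2\to S^5$. It is conformal at every point $(s,t)$ at which $w_1(t),w_2(t),w_3(t)$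 are all nonzero. If $A=\operatorname{Im}(w_1w_2w_3)(0)$ is not zero, then $\Phi$ is conformal on all of $\mathbb R^2$. -/

import Mathlib

open Set Metric
open scoped ContDiff

noncomputable section

/-! ### Jacobi elliptic functions -/

/-- The incomplete elliptic integral of the first kind
`F(φ, k) = ∫₀^φ dθ / √(1 - k² sin² θ)`. -/
def ellipticF (k φ : ℝ) : ℝ :=
  ∫ θ in (0 : ℝ)..φ, 1 / √(1 - k ^ 2 * Real.sin θ ^ 2)

/-- The maximal interval around `0` on which the integrand of `ellipticF k` is regular. It is the
whole line for `0 ≤ k < 1`, and `(-π/2, π/2)` for `k = 1`; for `0 ≤ k ≤ 1` the function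
`ellipticF k` is an increasing bijection from it onto the real line. -/
def ellipticDomain (k : ℝ) : Set ℝ :=
  {φ | ∀ θ ∈ uIcc 0 φ, 0 < 1 - k ^ 2 * Real.sin θ ^ 2}

/-- The Jacobi amplitude `am(x, k)`: the inverse function of `ellipticF k`. -/
def jacobiAm (x k : ℝ) : ℝ :=
  Function.invFunOn (ellipticF k) (ellipticDomain k) x

/-- The Jacobi elliptic function `sn(x, k)` with modulus `k ∈ [0, 1]`. -/
def jacobiSn (x k : ℝ) : ℝ := Real.sin (jacobiAm x k)

/-- The Jacobi elliptic function `cn(x, k)` with modulus `k ∈ [0, 1]`. -/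
def jacobiCn (x k : ℝ) : ℝ := Real.cos (jacobiAm x k)

/-- The Jacobi elliptic function `dn(x, k)` with modulus `k ∈ [0, 1]`. -/
def jacobiDn (x k : ℝ) : ℝ := √(1 - k ^ 2 * jacobiSn x k ^ 2)

/-! ### Harmonic and weakly conformal maps from a Euclidean space to a unit sphere -/

section Harmonic

variable {n : ℕ} {F : Type*} [NormedAddCommGroup F] [InnerProductSpace ℝ F]

/-- The covariant derivative at `x`, in the direction `v`, of a vector field `V` along a map `f`
into the unit sphere of `F`, with respect to the (pulled back) Levi-Civita connection of the round
metric: the derivative of `V` in `F`, projected orthogonally to the tangent space `f(x)ᗮ` of the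
sphere at `f(x)`. -/
def sphereCovDeriv (f V : EuclideanSpace ℝ (Fin n) → F) (x v : EuclideanSpace ℝ (Fin n)) : F :=
  (ℝ ∙ f x)ᗮ.starProjection (fderiv ℝ V x v)

/-- The tension field `tr (∇ df) = ∑ᵢ ∇_{∂ᵢ} (df(∂ᵢ))` of a map `f` from flat `ℝⁿ` to the unit
sphere of `F`. -/
def sphereTension (f : EuclideanSpace ℝ (Fin n) → F) (x : EuclideanSpace ℝ (Fin n)) : F :=
  ∑ i : Fin n, sphereCovDeriv f
    (fun y => fderiv ℝ f y (EuclideanSpace.single i 1)) x (EuclideanSpace.single i 1)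

/-- `f` is a harmonic map from flat `ℝⁿ` to the unit sphere of `F` with its round metric: it is
smooth, takes values in the sphere, and its tension field vanishes. -/
structure IsHarmonicMapToSphere (f : EuclideanSpace ℝ (Fin n) → F) : Prop where
  smooth : ContDiff ℝ ∞ f
  mem_sphere : ∀ x, f x ∈ sphere (0 : F) 1
  tension_eq_zero : ∀ x, sphereTension f x = 0

/-- `f` is weakly conformal: the metric induced by `f` on `ℝⁿ` is a nonnegative, possibly zero,
multiple of the flat metric at every point. -/
def IsWeaklyConformal (f : EuclideanSpace ℝ (Fin n) → F) : Prop :=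
  Differentiable ℝ f ∧ ∀ x, ∃ c : ℝ, 0 ≤ c ∧
    ∀ v v', inner ℝ (fderiv ℝ f x v) (fderiv ℝ f x v') = c * inner ℝ v v'

end Harmonic

/-! ### The ordinary differential equations and the map -/

/-- `w₁, w₂, w₃` satisfy, at every time in `I` (an open set below),
`dw₁/dt = conj (w₂ w₃)`, `dw₂/dt = - conj (w₃ w₁)`, `dw₃/dt = - conj (w₁ w₂)`. -/
structure SolvesOn (I : Set ℝ) (w₁ w₂ w₃ : ℝ → ℂ) : Prop where
  deriv₁ : ∀ t ∈ I, HasDerivAt w₁ (starRingEnd ℂ (w₂ t * w₃ t)) t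
  deriv₂ : ∀ t ∈ I, HasDerivAt w₂ (-starRingEnd ℂ (w₃ t * w₁ t)) t
  deriv₃ : ∀ t ∈ I, HasDerivAt w₃ (-starRingEnd ℂ (w₁ t * w₂ t)) t

/-- The map `Φ(s, t)`, where `μ = (α₁ + α₃)^{1/2}` and `ν = ((α₃ - α₂) / (α₁ + α₃))^{1/2}`. Here
`ℂ³` carries its standard Euclidean metric. -/
def jacobiMap (α₁ α₂ α₃ : ℝ) (w₁ w₂ w₃ : ℝ → ℂ) (p : EuclideanSpace ℝ (Fin 2)) :
    EuclideanSpace ℂ (Fin 3) :=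
  let μ : ℝ := √(α₁ + α₃)
  let ν : ℝ := √((α₃ - α₂) / (α₁ + α₃))
  let s : ℝ := p 0
  let t : ℝ := p 1
  !₂[(((√(α₁ + α₂))⁻¹ * jacobiDn (μ * s) ν : ℝ) : ℂ) * w₁ t,
     (((√(α₁ + α₂))⁻¹ * jacobiCn (μ * s) ν : ℝ) : ℂ) * w₂ t,
     (((√(α₁ + α₃))⁻¹ * jacobiSn (μ * s) ν : ℝ) : ℂ) * w₃ t]

end

/-! The equations conserve `|w₁|² + |w₂|²` and `|w₁|² + |w₃|²`, so solutions stay bounded and extend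
to the whole line.

Each coordinate of `Φ` is a real function of `s` times a complex function of `t`, and each factor
satisfies an equation `f'' = p f` with real `p`. On the Jacobi side `p` involves only `sn²`; on the
ODE side it involves only the `|wᵢ|²`. The two coefficients have the same sum `l` in all three
coordinates (`weightedVec_add_of_eigen`), so `ΔΦ = l Φ` is normal to the sphere and the tension
vanishes. Conformality says that the two partial derivatives are orthogonal and of equal length;
both are algebraic identities in `sn`, `cn`, `dn` and the `wᵢ`. Finally `Im (w₁ w₂ w₃)` is
conserved, so if it is nonzero at `0`, no `wᵢ` ever vanishes. -/

open scoped NNReal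

/-! ### Global existence and smoothness for the differential equations -/

/-- A bounded, globally Lipschitz autonomous vector field has complete integral curves. -/
theorem exists_global_integralCurve {E : Type*} [NormedAddCommGroup E] [NormedSpace ℝ E]
    [CompleteSpace E] {v : E → E} {K L : ℝ≥0} (hv : LipschitzWith K v) (hL : ∀ x, ‖v x‖ ≤ L)
    (x₀ : E) : ∃ γ : ℝ → E, γ 0 = x₀ ∧ ∀ t, HasDerivAt γ (v (γ t)) t := by
  have hloc : ∀ n : ℕ, ∃ γ : ℝ → E, γ 0 = x₀ ∧
      ∀ t ∈ Ioo (-(n + 1 : ℝ)) (n + 1), HasDerivAt γ (v (γ t)) t := by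
    intro n
    have h0 : (0 : ℝ) ∈ Icc (-(n + 1 : ℝ)) (n + 1) := ⟨by linarith, by positivity⟩
    -- At speed at most `L` a curve travels at most `L * (n + 1)`, so a ball of that radius puts no
    -- limit on the time.
    have hPL : IsPicardLindelof (fun _ => v) (⟨0, h0⟩ : Icc (-(n + 1 : ℝ)) (n + 1)) x₀
        (L * (n + 1)) 0 L K :=
      { lipschitzOnWith := fun t _ => hv.lipschitzOnWith
        continuousOn := fun x _ => continuousOn_const
        norm_le := fun t _ x _ => hL x
        mul_max_le := by simp }
    obtain ⟨γ, h, h'⟩ := hPL.exists_eq_forall_mem_Icc_hasDerivWithinAt₀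
    exact ⟨γ, h, fun t ht => (h' t (Ioo_subset_Icc_self ht)).hasDerivAt (Icc_mem_nhds ht.1 ht.2)⟩
  choose γ hγ0 hγ using hloc
  have huniq : ∀ m n : ℕ, m ≤ n → EqOn (γ m) (γ n) (Ioo (-(m + 1 : ℝ)) (m + 1)) := by
    intro m n hmn
    have hmn' : (m : ℝ) ≤ n := by exact_mod_cast hmn
    have h0 : (0 : ℝ) ∈ Ioo (-(m + 1 : ℝ)) (m + 1) := ⟨by linarith, by positivity⟩
    refine ODE_solution_unique_of_mem_Ioo (v := fun _ => v) (s := fun _ => univ) (K := K)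
      (fun t _ => hv.lipschitzOnWith) h0 (fun t ht => ⟨hγ m t ht, mem_univ _⟩)
      (fun t ht => ⟨hγ n t ⟨by linarith [ht.1], by linarith [ht.2]⟩, mem_univ _⟩) ?_
    rw [hγ0, hγ0]
  refine ⟨fun t => γ ⌈|t|⌉₊ t, by simpa using hγ0 0, fun t => ?_⟩
  have hmem : ∀ s : ℝ, s ∈ Ioo (-(⌈|s|⌉₊ + 1 : ℝ)) (⌈|s|⌉₊ + 1) := fun s =>
    abs_lt.1 ((Nat.le_ceil |s|).trans_lt (lt_add_one _))
  -- The index `⌈|s|⌉₊` can jump at `t`; the curve with the next index covers a whole neighbourhood.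
  have hev : (fun s => γ ⌈|s|⌉₊ s) =ᶠ[nhds t] γ (⌈|t|⌉₊ + 1) := by
    filter_upwards [Ioo_mem_nhds (hmem t).1 (hmem t).2] with s hs
    refine huniq _ _ (Nat.ceil_le.2 ?_) (hmem s)
    push_cast
    exact (abs_lt.2 hs).le
  have hd := hγ (⌈|t|⌉₊ + 1) t (by
    have := hmem t; push_cast; exact ⟨by linarith [this.1], by linarith [this.2]⟩)
  rw [← hev.eq_of_nhds] at hd
  exact hd.congr_of_eventuallyEq hev

/-- Integral curves of a smooth vector field are smooth. -/
theorem contDiff_of_integralCurve {E : Type*} [NormedAddCommGroup E] [NormedSpace ℝ E]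
    {v : E → E} (hv : ContDiff ℝ ∞ v) {γ : ℝ → E} (hγ : ∀ t, HasDerivAt γ (v (γ t)) t) :
    ContDiff ℝ ∞ γ := by
  have hderiv : deriv γ = v ∘ γ := funext fun t => (hγ t).deriv
  have hdiff : Differentiable ℝ γ := fun t => (hγ t).differentiableAt
  refine contDiff_infty.2 fun n => ?_
  induction n with
  | zero => exact contDiff_zero.2 hdiff.continuous
  | succ n ih =>
    -- Bootstrap: `γ' = v ∘ γ` is as regular as `γ`, so `γ` gains a derivative.
    push_cast
    refine contDiff_succ_iff_deriv.2 ⟨hdiff, by simp, ?_⟩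
    rw [hderiv]
    exact (hv.of_le (by exact_mod_cast le_top)).comp ih

/-- The quadratic vector field on `ℂ³` whose integral curves are the solutions of `SolvesOn`. -/
def crossField (x : ℂ × ℂ × ℂ) : ℂ × ℂ × ℂ :=
  (starRingEnd ℂ (x.2.1 * x.2.2), -starRingEnd ℂ (x.2.2 * x.1), -starRingEnd ℂ (x.1 * x.2.1))

theorem contDiff_conj_comp {E : Type*} [NormedAddCommGroup E] [NormedSpace ℝ E] {f : E → ℂ}
    (hf : ContDiff ℝ ∞ f) : ContDiff ℝ ∞ fun x => starRingEnd ℂ (f x) :=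
  Complex.conjCLE.contDiff.comp hf

theorem contDiff_crossField : ContDiff ℝ ∞ crossField := by
  refine ContDiff.prodMk (contDiff_conj_comp (by fun_prop))
    (ContDiff.prodMk (contDiff_conj_comp (by fun_prop)).neg (contDiff_conj_comp (by fun_prop)).neg)

theorem hasDerivAt_norm_sq_complex {w : ℝ → ℂ} {w' : ℂ} {t : ℝ} (h : HasDerivAt w w' t) :
    HasDerivAt (fun t => ‖w t‖ ^ 2) (2 * (starRingEnd ℂ (w t) * w').re) t := by
  convert h.norm_sq using 1
  rw [Complex.inner, mul_comm w']

/-- The conserved quantities, for an arbitrary time change of the equations. -/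
theorem norm_sq_add_conserved {w₁ w₂ w₃ : ℝ → ℂ} {c : ℝ → ℝ} {I : Set ℝ} (hI : IsOpen I)
    (hI' : IsPreconnected I)
    (h₁ : ∀ t ∈ I, HasDerivAt w₁ ((c t : ℂ) * starRingEnd ℂ (w₂ t * w₃ t)) t)
    (h₂ : ∀ t ∈ I, HasDerivAt w₂ ((c t : ℂ) * -starRingEnd ℂ (w₃ t * w₁ t)) t)
    {s t : ℝ} (hs : s ∈ I) (ht : t ∈ I) :
    ‖w₁ s‖ ^ 2 + ‖w₂ s‖ ^ 2 = ‖w₁ t‖ ^ 2 + ‖w₂ t‖ ^ 2 := by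
  have hd : ∀ r ∈ I, HasDerivAt (fun r => ‖w₁ r‖ ^ 2 + ‖w₂ r‖ ^ 2) 0 r := fun r hr => by
    refine ((hasDerivAt_norm_sq_complex (h₁ r hr)).add
      (hasDerivAt_norm_sq_complex (h₂ r hr))).congr_deriv ?_
    simp
    ring
  exact hI.is_const_of_deriv_eq_zero hI' (fun r hr => (hd r hr).differentiableAt.differentiableWithinAt)
    (fun r hr => (hd r hr).deriv) hs ht

/-- Cutting the field off makes it globally Lipschitz. The cutoff is a real factor, so it preserves
the conservation laws, and these confine the curve to the region where the cutoff equals `1`. -/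
theorem SolvesOn.extend {ε : ℝ} (hε : 0 < ε) {w₁ w₂ w₃ : ℝ → ℂ}
    (h : SolvesOn (Ioo (-ε) ε) w₁ w₂ w₃) :
    ∃ W₁ W₂ W₃ : ℝ → ℂ, SolvesOn univ W₁ W₂ W₃ ∧
      EqOn W₁ w₁ (Ioo (-ε) ε) ∧ EqOn W₂ w₂ (Ioo (-ε) ε) ∧ EqOn W₃ w₃ (Ioo (-ε) ε) := by
  -- The sum of the two conserved quantities dominates every `|wᵢ|²`. The `+ 1` in the inner radius
  -- below keeps it positive even when `B = 0`.
  set B : ℝ := ‖w₁ 0‖ ^ 2 + ‖w₂ 0‖ ^ 2 + (‖w₁ 0‖ ^ 2 + ‖w₃ 0‖ ^ 2) with hB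
  have hB0 : 0 ≤ B := by positivity
  let χ : ContDiffBump (0 : ℂ × ℂ × ℂ) :=
    ⟨√B + 1, √B + 2, by positivity, by linarith⟩
  have hχ : ∀ a b c : ℂ, ‖a‖ ^ 2 + ‖b‖ ^ 2 + (‖a‖ ^ 2 + ‖c‖ ^ 2) = B → χ (a, b, c) = 1 := by
    intro a b c habc
    apply χ.one_of_mem_closedBall
    have key : ∀ z : ℂ, ‖z‖ ^ 2 ≤ B → ‖z‖ ≤ √B + 1 := fun z hz =>
      (Real.le_sqrt_of_sq_le hz).trans (by linarith)
    simp only [mem_closedBall, dist_zero_right, Prod.norm_def, sup_le_iff]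
    refine ⟨key _ ?_, key _ ?_, key _ ?_⟩ <;> rw [← habc] <;> nlinarith [sq_nonneg ‖a‖, sq_nonneg ‖b‖, sq_nonneg ‖c‖]
  let v : ℂ × ℂ × ℂ → ℂ × ℂ × ℂ := fun x => χ x • crossField x
  have hvs : ContDiff ℝ ∞ v := χ.contDiff.smul contDiff_crossField
  have hvc : HasCompactSupport v := χ.hasCompactSupport.smul_right
  obtain ⟨K, hK⟩ := ContDiff.lipschitzWith_of_hasCompactSupport hvc hvs (by simp)
  obtain ⟨L, hL⟩ := hvc.exists_bound_of_continuous hvs.continuous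
  have hL' : ∀ x, ‖v x‖ ≤ L.toNNReal := fun x => (hL x).trans (Real.le_coe_toNNReal L)
  obtain ⟨γ, hγ0, hγ⟩ := exists_global_integralCurve hK hL' (w₁ 0, w₂ 0, w₃ 0)
  have d₁ : ∀ t, HasDerivAt (fun t => (γ t).1)
      ((χ (γ t) : ℂ) * starRingEnd ℂ ((γ t).2.1 * (γ t).2.2)) t := fun t => (hγ t).fst
  have d₂ : ∀ t, HasDerivAt (fun t => (γ t).2.1)
      ((χ (γ t) : ℂ) * -starRingEnd ℂ ((γ t).2.2 * (γ t).1)) t := fun t => (hγ t).snd.fst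
  have d₃ : ∀ t, HasDerivAt (fun t => (γ t).2.2)
      ((χ (γ t) : ℂ) * -starRingEnd ℂ ((γ t).1 * (γ t).2.1)) t := fun t => (hγ t).snd.snd
  have hone : ∀ t, χ (γ t) = 1 := fun t => by
    refine hχ _ _ _ ?_
    have e₁ := norm_sq_add_conserved isOpen_univ isPreconnected_univ (fun t _ => d₁ t)
      (fun t _ => d₂ t) (mem_univ t) (mem_univ 0)
    -- The second law is the first with the roles of `w₂` and `w₃` exchanged.
    have e₂ := norm_sq_add_conserved (w₁ := fun t => (γ t).1) (w₂ := fun t => (γ t).2.2)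
      (w₃ := fun t => (γ t).2.1) (c := fun t => χ (γ t)) isOpen_univ isPreconnected_univ
      (fun t _ => by simpa only [mul_comm (γ t).2.2] using d₁ t)
      (fun t _ => by simpa only [mul_comm (γ t).2.1] using d₃ t) (mem_univ t) (mem_univ 0)
    rw [e₁, e₂, hγ0]
  have h0 : (0 : ℝ) ∈ Ioo (-ε) ε := ⟨by linarith, hε⟩
  have hone' : ∀ t ∈ Ioo (-ε) ε, χ (w₁ t, w₂ t, w₃ t) = 1 := fun t ht => by
    refine hχ _ _ _ ?_
    rw [norm_sq_add_conserved (c := fun _ => 1) isOpen_Ioo isPreconnected_Ioo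
        (fun t ht => by simpa using h.deriv₁ t ht) (fun t ht => by simpa using h.deriv₂ t ht) ht h0,
      norm_sq_add_conserved (c := fun _ => 1) (w₃ := w₂) isOpen_Ioo isPreconnected_Ioo
        (fun t ht => by simpa [mul_comm] using h.deriv₁ t ht)
        (fun t ht => by simpa [mul_comm] using h.deriv₃ t ht) ht h0]
  have huniq : EqOn γ (fun t => (w₁ t, w₂ t, w₃ t)) (Ioo (-ε) ε) :=
    ODE_solution_unique_of_mem_Ioo (v := fun _ => v) (s := fun _ => univ) (K := K)
      (fun t _ => hK.lipschitzOnWith) h0 (fun t _ => ⟨hγ t, mem_univ _⟩)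
      (fun t ht => ⟨by
        simp only [v, hone' t ht, one_smul]
        exact (h.deriv₁ t ht).prodMk ((h.deriv₂ t ht).prodMk (h.deriv₃ t ht)), mem_univ _⟩) hγ0
  refine ⟨fun t => (γ t).1, fun t => (γ t).2.1, fun t => (γ t).2.2,
    ⟨fun t _ => ?_, fun t _ => ?_, fun t _ => ?_⟩,
    fun t ht => by simp [huniq ht], fun t ht => by simp [huniq ht], fun t ht => by simp [huniq ht]⟩
  · simpa [hone t] using d₁ t
  · simpa [hone t] using d₂ t
  · simpa [hone t] using d₃ t

theorem SolvesOn.contDiff {w₁ w₂ w₃ : ℝ → ℂ} (h : SolvesOn univ w₁ w₂ w₃) :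
    ContDiff ℝ ∞ w₁ ∧ ContDiff ℝ ∞ w₂ ∧ ContDiff ℝ ∞ w₃ := by
  have := contDiff_of_integralCurve contDiff_crossField (γ := fun t => (w₁ t, w₂ t, w₃ t))
    fun t => (h.deriv₁ t trivial).prodMk ((h.deriv₂ t trivial).prodMk (h.deriv₃ t trivial))
  exact ⟨this.fst, this.snd.fst, this.snd.snd⟩

/-! ### Jacobi elliptic functions with modulus `k² < 1` -/

section Jacobi

variable {k : ℝ}

theorem one_sub_sq_mul_sin_sq_pos (hk : k ^ 2 < 1) (θ : ℝ) :
    0 < 1 - k ^ 2 * Real.sin θ ^ 2 := by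
  nlinarith [Real.sin_sq_le_one θ, sq_nonneg (Real.sin θ), sq_nonneg k]

theorem ellipticDomain_eq_univ (hk : k ^ 2 < 1) : ellipticDomain k = univ :=
  eq_univ_of_forall fun _ _ _ => one_sub_sq_mul_sin_sq_pos hk _

theorem hasDerivAt_ellipticF (hk : k ^ 2 < 1) (φ : ℝ) :
    HasDerivAt (ellipticF k) (1 / √(1 - k ^ 2 * Real.sin φ ^ 2)) φ := by
  have hc : Continuous fun θ : ℝ => 1 / √(1 - k ^ 2 * Real.sin θ ^ 2) :=
    continuous_const.div (by fun_prop)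
      fun θ => (Real.sqrt_pos.2 (one_sub_sq_mul_sin_sq_pos hk θ)).ne'
  exact intervalIntegral.integral_hasDerivAt_right (hc.intervalIntegrable _ _)
    hc.aestronglyMeasurable.stronglyMeasurableAtFilter hc.continuousAt

/-- The integrand is at least `1`. This expansion gives surjectivity of `ellipticF k` and makes its
inverse 1-Lipschitz. -/
theorem sub_le_ellipticF_sub (hk : k ^ 2 < 1) {a b : ℝ} (hab : a ≤ b) :
    b - a ≤ ellipticF k b - ellipticF k a := by
  have hd : ∀ x, HasDerivAt (fun x => ellipticF k x - x)
      (1 / √(1 - k ^ 2 * Real.sin x ^ 2) - 1) x := fun x =>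
    (hasDerivAt_ellipticF hk x).sub (hasDerivAt_id x)
  have hm : Monotone fun x => ellipticF k x - x := by
    refine monotone_of_deriv_nonneg (fun x => (hd x).differentiableAt) fun x => ?_
    rw [(hd x).deriv, sub_nonneg, le_div_iff₀ (Real.sqrt_pos.2 (one_sub_sq_mul_sin_sq_pos hk x)),
      one_mul]
    refine Real.sqrt_le_one.2 ?_
    nlinarith [mul_nonneg (sq_nonneg k) (sq_nonneg (Real.sin x))]
  linarith [hm hab]

theorem ellipticF_zero : ellipticF k 0 = 0 := by simp [ellipticF]

theorem ellipticF_surjective (hk : k ^ 2 < 1) : Function.Surjective (ellipticF k) := by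
  have hc : Continuous (ellipticF k) :=
    continuous_iff_continuousAt.2 fun x => (hasDerivAt_ellipticF hk x).continuousAt
  refine hc.surjective ?_ ?_
  · refine Filter.tendsto_atTop_mono' _ ?_ Filter.tendsto_id
    filter_upwards [Filter.eventually_ge_atTop 0] with x hx
    simpa [ellipticF_zero] using sub_le_ellipticF_sub hk hx
  · refine Filter.tendsto_atBot_mono' _ ?_ Filter.tendsto_id
    filter_upwards [Filter.eventually_le_atBot 0] with x hx
    simpa [ellipticF_zero] using sub_le_ellipticF_sub hk hx

theorem ellipticF_jacobiAm (hk : k ^ 2 < 1) (x : ℝ) : ellipticF k (jacobiAm x k) = x := by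
  obtain ⟨φ, hφ⟩ := ellipticF_surjective hk x
  exact Function.invFunOn_eq ⟨φ, by simp [ellipticDomain_eq_univ hk], hφ⟩

theorem continuous_jacobiAm (hk : k ^ 2 < 1) : Continuous fun x => jacobiAm x k := by
  refine (LipschitzWith.of_le_add fun x y => ?_).continuous
  rcases le_total (jacobiAm y k) (jacobiAm x k) with h | h
  · have := sub_le_ellipticF_sub hk h
    rw [ellipticF_jacobiAm hk, ellipticF_jacobiAm hk] at this
    have := le_abs_self (x - y)
    rw [Real.dist_eq]
    linarith
  · linarith [dist_nonneg (x := x) (y := y)]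

theorem hasDerivAt_jacobiAm (hk : k ^ 2 < 1) (x : ℝ) :
    HasDerivAt (fun x => jacobiAm x k) (jacobiDn x k) x := by
  have hpos := Real.sqrt_pos.2 (one_sub_sq_mul_sin_sq_pos hk (jacobiAm x k))
  have := HasDerivAt.of_local_left_inverse (f := ellipticF k) (g := fun x => jacobiAm x k)
    (continuous_jacobiAm hk).continuousAt (hasDerivAt_ellipticF hk _) (by positivity)
    (Filter.Eventually.of_forall fun y => ellipticF_jacobiAm hk y)
  simpa [jacobiDn, jacobiSn] using this

theorem jacobiDn_pos (hk : k ^ 2 < 1) (x : ℝ) : 0 < jacobiDn x k :=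
  Real.sqrt_pos.2 (one_sub_sq_mul_sin_sq_pos hk _)

theorem jacobiDn_sq (hk : k ^ 2 < 1) (x : ℝ) :
    jacobiDn x k ^ 2 = 1 - k ^ 2 * jacobiSn x k ^ 2 :=
  Real.sq_sqrt (one_sub_sq_mul_sin_sq_pos hk _).le

theorem jacobiCn_sq (x : ℝ) : jacobiCn x k ^ 2 = 1 - jacobiSn x k ^ 2 :=
  Real.cos_sq' _

theorem hasDerivAt_jacobiSn (hk : k ^ 2 < 1) (x : ℝ) :
    HasDerivAt (fun x => jacobiSn x k) (jacobiCn x k * jacobiDn x k) x :=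
  (hasDerivAt_jacobiAm hk x).sin

theorem hasDerivAt_jacobiCn (hk : k ^ 2 < 1) (x : ℝ) :
    HasDerivAt (fun x => jacobiCn x k) (-(jacobiSn x k * jacobiDn x k)) x :=
  ((hasDerivAt_jacobiAm hk x).cos).congr_deriv (neg_mul _ _)

theorem hasDerivAt_jacobiDn (hk : k ^ 2 < 1) (x : ℝ) :
    HasDerivAt (fun x => jacobiDn x k) (-(k ^ 2 * (jacobiSn x k * jacobiCn x k))) x := by
  have hpos := jacobiDn_pos hk x
  have := ((((hasDerivAt_jacobiSn hk x).pow 2).const_mul (k ^ 2)).const_sub 1).sqrt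
    (one_sub_sq_mul_sin_sq_pos hk _).ne'
  refine this.congr_deriv ?_
  change _ / (2 * jacobiDn x k) = _
  field_simp
  norm_num
  ring

theorem contDiff_jacobiAm (hk : k ^ 2 < 1) : ContDiff ℝ ∞ fun x => jacobiAm x k := by
  -- The amplitude solves the autonomous equation `φ' = √(1 - k² sin² φ)`.
  refine contDiff_of_integralCurve (v := fun φ => √(1 - k ^ 2 * Real.sin φ ^ 2)) ?_
    (hasDerivAt_jacobiAm hk)
  exact ContDiff.sqrt (by fun_prop) fun φ => (one_sub_sq_mul_sin_sq_pos hk φ).ne'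

theorem contDiff_jacobiSn (hk : k ^ 2 < 1) : ContDiff ℝ ∞ fun x => jacobiSn x k :=
  (contDiff_jacobiAm hk).sin

theorem contDiff_jacobiCn (hk : k ^ 2 < 1) : ContDiff ℝ ∞ fun x => jacobiCn x k :=
  (contDiff_jacobiAm hk).cos

theorem contDiff_jacobiDn (hk : k ^ 2 < 1) : ContDiff ℝ ∞ fun x => jacobiDn x k :=
  ContDiff.sqrt (contDiff_const.sub (contDiff_const.mul ((contDiff_jacobiSn hk).pow 2)))
    fun _ => (one_sub_sq_mul_sin_sq_pos hk _).ne'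

end Jacobi

/-! ### Maps to `ℂ³` with separated variables -/

/-- The vector of `ℂ³` with coordinates `a * x`, `b * y`, `c * z`, for real `a`, `b`, `c`. -/
def weightedVec (a b c : ℝ) (x y z : ℂ) : EuclideanSpace ℂ (Fin 3) :=
  !₂[(a : ℂ) * x, (b : ℂ) * y, (c : ℂ) * z]

theorem inner_weightedVec (a b c a' b' c' : ℝ) (x y z x' y' z' : ℂ) :
    inner ℝ (weightedVec a b c x y z) (weightedVec a' b' c' x' y' z') =
      a * a' * (starRingEnd ℂ x * x').re + b * b' * (starRingEnd ℂ y * y').re +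
        c * c' * (starRingEnd ℂ z * z').re := by
  rw [PiLp.inner_apply]
  simp [Fin.sum_univ_three, Complex.inner, weightedVec]
  ring

theorem inner_self_weightedVec (a b c : ℝ) (x y z : ℂ) :
    inner ℝ (weightedVec a b c x y z) (weightedVec a b c x y z) =
      a ^ 2 * ‖x‖ ^ 2 + b ^ 2 * ‖y‖ ^ 2 + c ^ 2 * ‖z‖ ^ 2 := by
  rw [inner_weightedVec]
  simp only [Complex.conj_mul', ← Complex.ofReal_pow, Complex.ofReal_re]
  ring

/-- Separation of variables: the two summands are to be `∂ₛ²Φ` and `∂ₜ²Φ`, so the Laplacian is a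
multiple of `Φ`. -/
theorem weightedVec_add_of_eigen {a b c a'' b'' c'' p₁ p₂ p₃ q₁ q₂ q₃ l : ℝ}
    {x y z x'' y'' z'' : ℂ} (ha : a'' = p₁ * a) (hb : b'' = p₂ * b) (hc : c'' = p₃ * c)
    (hx : x'' = (q₁ : ℂ) * x) (hy : y'' = (q₂ : ℂ) * y) (hz : z'' = (q₃ : ℂ) * z)
    (h₁ : p₁ + q₁ = l) (h₂ : p₂ + q₂ = l) (h₃ : p₃ + q₃ = l) :
    weightedVec a'' b'' c'' x y z + weightedVec a b c x'' y'' z'' =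
      l • weightedVec a b c x y z := by
  have e₁ : (l : ℂ) = p₁ + q₁ := by rw [← h₁]; push_cast; rfl
  have e₂ : (l : ℂ) = p₂ + q₂ := by rw [← h₂]; push_cast; rfl
  have e₃ : (l : ℂ) = p₃ + q₃ := by rw [← h₃]; push_cast; rfl
  ext i
  fin_cases i
  · simp [weightedVec, ha, hx, e₁]
    ring
  · simp [weightedVec, hb, hy, e₂]
    ring
  · simp [weightedVec, hc, hz, e₃]
    ring

theorem hasFDerivAt_mul_comp_coord {a : ℝ → ℝ} {x : ℝ → ℂ} {a' : ℝ} {x' : ℂ}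
    {p : EuclideanSpace ℝ (Fin 2)} (ha : HasDerivAt a a' (p 0)) (hx : HasDerivAt x x' (p 1)) :
    HasFDerivAt (fun p : EuclideanSpace ℝ (Fin 2) => (a (p 0) : ℂ) * x (p 1))
      ((EuclideanSpace.proj (𝕜 := ℝ) (0 : Fin 2)).smulRight ((a' : ℂ) * x (p 1)) +
        (EuclideanSpace.proj (𝕜 := ℝ) (1 : Fin 2)).smulRight ((a (p 0) : ℂ) * x')) p := by
  have h0 := HasFDerivAt.comp (g := fun s => (a s : ℂ)) p ha.ofReal_comp.hasFDerivAt
    (EuclideanSpace.proj (0 : Fin 2) : EuclideanSpace ℝ (Fin 2) →L[ℝ] ℝ).hasFDerivAt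
  have h1 := HasFDerivAt.comp (g := x) p hx.hasFDerivAt
    (EuclideanSpace.proj (1 : Fin 2) : EuclideanSpace ℝ (Fin 2) →L[ℝ] ℝ).hasFDerivAt
  refine (h0.mul h1).congr_fderiv ?_
  ext v
  simp
  ring

theorem hasFDerivAt_weightedVec {a b c : ℝ → ℝ} {x y z : ℝ → ℂ} {a' b' c' : ℝ} {x' y' z' : ℂ}
    {p : EuclideanSpace ℝ (Fin 2)} (ha : HasDerivAt a a' (p 0)) (hb : HasDerivAt b b' (p 0))
    (hc : HasDerivAt c c' (p 0)) (hx : HasDerivAt x x' (p 1)) (hy : HasDerivAt y y' (p 1))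
    (hz : HasDerivAt z z' (p 1)) :
    HasFDerivAt (fun p : EuclideanSpace ℝ (Fin 2) =>
        weightedVec (a (p 0)) (b (p 0)) (c (p 0)) (x (p 1)) (y (p 1)) (z (p 1)))
      ((EuclideanSpace.proj (𝕜 := ℝ) (0 : Fin 2)).smulRight
          (weightedVec a' b' c' (x (p 1)) (y (p 1)) (z (p 1))) +
        (EuclideanSpace.proj (𝕜 := ℝ) (1 : Fin 2)).smulRight
          (weightedVec (a (p 0)) (b (p 0)) (c (p 0)) x' y' z')) p := by
  rw [← hasFDerivWithinAt_univ, hasFDerivWithinAt_piLp]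
  intro i
  rw [hasFDerivWithinAt_univ]
  fin_cases i
  · exact (hasFDerivAt_mul_comp_coord ha hx).congr_fderiv (by ext v; simp [weightedVec])
  · exact (hasFDerivAt_mul_comp_coord hb hy).congr_fderiv (by ext v; simp [weightedVec])
  · exact (hasFDerivAt_mul_comp_coord hc hz).congr_fderiv (by ext v; simp [weightedVec])

theorem contDiff_weightedVec {a b c : ℝ → ℝ} {x y z : ℝ → ℂ} (ha : ContDiff ℝ ∞ a)
    (hb : ContDiff ℝ ∞ b) (hc : ContDiff ℝ ∞ c) (hx : ContDiff ℝ ∞ x) (hy : ContDiff ℝ ∞ y)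
    (hz : ContDiff ℝ ∞ z) :
    ContDiff ℝ ∞ fun p : EuclideanSpace ℝ (Fin 2) =>
      weightedVec (a (p 0)) (b (p 0)) (c (p 0)) (x (p 1)) (y (p 1)) (z (p 1)) := by
  have key : ∀ {f : ℝ → ℝ} {w : ℝ → ℂ}, ContDiff ℝ ∞ f → ContDiff ℝ ∞ w →
      ContDiff ℝ ∞ fun p : EuclideanSpace ℝ (Fin 2) => (f (p 0) : ℂ) * w (p 1) := by
    intro f w hf hw
    exact (Complex.ofRealCLM.contDiff.comp (hf.comp (by fun_prop))).mul (hw.comp (by fun_prop))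
  rw [contDiff_piLp]
  intro i
  fin_cases i
  · exact key ha hx
  · exact key hb hy
  · exact key hc hz

/-- The tension field of a map whose coordinates are products of a function of `s` and a function
of `t`. -/
theorem sphereTension_weightedVec {a b c a' b' c' a'' b'' c'' : ℝ → ℝ}
    {x y z x' y' z' x'' y'' z'' : ℝ → ℂ}
    (ha : ∀ s, HasDerivAt a (a' s) s) (hb : ∀ s, HasDerivAt b (b' s) s)
    (hc : ∀ s, HasDerivAt c (c' s) s)
    (ha' : ∀ s, HasDerivAt a' (a'' s) s) (hb' : ∀ s, HasDerivAt b' (b'' s) s)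
    (hc' : ∀ s, HasDerivAt c' (c'' s) s)
    (hx : ∀ s, HasDerivAt x (x' s) s) (hy : ∀ s, HasDerivAt y (y' s) s)
    (hz : ∀ s, HasDerivAt z (z' s) s)
    (hx' : ∀ s, HasDerivAt x' (x'' s) s) (hy' : ∀ s, HasDerivAt y' (y'' s) s)
    (hz' : ∀ s, HasDerivAt z' (z'' s) s) (p : EuclideanSpace ℝ (Fin 2)) :
    sphereTension (fun p : EuclideanSpace ℝ (Fin 2) =>
        weightedVec (a (p 0)) (b (p 0)) (c (p 0)) (x (p 1)) (y (p 1)) (z (p 1))) p =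
      (ℝ ∙ weightedVec (a (p 0)) (b (p 0)) (c (p 0)) (x (p 1)) (y (p 1)) (z (p 1)))ᗮ.starProjection
        (weightedVec (a'' (p 0)) (b'' (p 0)) (c'' (p 0)) (x (p 1)) (y (p 1)) (z (p 1)) +
          weightedVec (a (p 0)) (b (p 0)) (c (p 0)) (x'' (p 1)) (y'' (p 1)) (z'' (p 1))) := by
  have e := fun q : EuclideanSpace ℝ (Fin 2) => (hasFDerivAt_weightedVec (ha (q 0)) (hb (q 0))
    (hc (q 0)) (hx (q 1)) (hy (q 1)) (hz (q 1))).fderiv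
  have e₀ := (hasFDerivAt_weightedVec (ha' (p 0)) (hb' (p 0))
    (hc' (p 0)) (hx (p 1)) (hy (p 1)) (hz (p 1))).fderiv
  have e₁ := (hasFDerivAt_weightedVec (ha (p 0)) (hb (p 0))
    (hc (p 0)) (hx' (p 1)) (hy' (p 1)) (hz' (p 1))).fderiv
  rw [map_add]
  simp [sphereTension, sphereCovDeriv, Fin.sum_univ_two, e, e₀, e₁]
  abel

theorem starProjection_orthogonal_span_smul {F : Type*} [NormedAddCommGroup F]
    [InnerProductSpace ℝ F] (l : ℝ) (v : F) : (ℝ ∙ v)ᗮ.starProjection (l • v) = 0 := by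
  rw [Submodule.starProjection_apply_eq_zero_iff, Submodule.orthogonal_orthogonal,
    Submodule.mem_span_singleton]
  exact ⟨l, rfl⟩

theorem inner_fderiv_of_orthogonal_partials {F : Type*} [NormedAddCommGroup F]
    [InnerProductSpace ℝ F] {f : EuclideanSpace ℝ (Fin 2) → F} {p : EuclideanSpace ℝ (Fin 2)}
    {X Y : F} (hf : HasFDerivAt f ((EuclideanSpace.proj (𝕜 := ℝ) (0 : Fin 2)).smulRight X +
      (EuclideanSpace.proj (𝕜 := ℝ) (1 : Fin 2)).smulRight Y) p)
    (hXY : inner ℝ X Y = 0) (hXX : inner ℝ X X = inner ℝ Y Y) (v v' : EuclideanSpace ℝ (Fin 2)) :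
    inner ℝ (fderiv ℝ f p v) (fderiv ℝ f p v') = inner ℝ X X * inner ℝ v v' := by
  have hYX : inner ℝ Y X = 0 := by rw [real_inner_comm, hXY]
  rw [hf.fderiv, PiLp.inner_apply]
  simp only [add_apply, ContinuousLinearMap.smulRight_apply,
    PiLp.proj_apply, inner_add_left, inner_add_right, inner_smul_left, inner_smul_right,
    hXY, hYX, ← hXX, Fin.sum_univ_two]
  simp
  ring

/-! ### Second derivatives and conserved quantities of solutions -/

section Solutions

variable {w₁ w₂ w₃ : ℝ → ℂ}

/-- Differentiating a conjugated product conjugates twice, which returns `w₁` itself times real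
squared norms; likewise for the other two. -/
theorem SolvesOn.second_deriv₁ (h : SolvesOn univ w₁ w₂ w₃) (t : ℝ) :
    HasDerivAt (fun t => starRingEnd ℂ (w₂ t * w₃ t))
      ((-(‖w₂ t‖ ^ 2 + ‖w₃ t‖ ^ 2) : ℝ) * w₁ t) t := by
  refine ((h.deriv₂ t trivial).mul (h.deriv₃ t trivial)).star.congr_deriv ?_
  push_cast
  rw [← starRingEnd_apply, ← Complex.conj_mul', ← Complex.conj_mul']
  simp
  ring

theorem SolvesOn.second_deriv₂ (h : SolvesOn univ w₁ w₂ w₃) (t : ℝ) :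
    HasDerivAt (fun t => -starRingEnd ℂ (w₃ t * w₁ t))
      ((‖w₁ t‖ ^ 2 - ‖w₃ t‖ ^ 2 : ℝ) * w₂ t) t := by
  refine ((h.deriv₃ t trivial).mul (h.deriv₁ t trivial)).star.neg.congr_deriv ?_
  push_cast
  rw [← starRingEnd_apply, ← Complex.conj_mul', ← Complex.conj_mul']
  simp
  ring

theorem SolvesOn.second_deriv₃ (h : SolvesOn univ w₁ w₂ w₃) (t : ℝ) :
    HasDerivAt (fun t => -starRingEnd ℂ (w₁ t * w₂ t))
      ((‖w₁ t‖ ^ 2 - ‖w₂ t‖ ^ 2 : ℝ) * w₃ t) t := by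
  refine ((h.deriv₁ t trivial).mul (h.deriv₂ t trivial)).star.neg.congr_deriv ?_
  push_cast
  rw [← starRingEnd_apply, ← Complex.conj_mul', ← Complex.conj_mul']
  simp
  ring

theorem SolvesOn.im_mul_eq (h : SolvesOn univ w₁ w₂ w₃) (s t : ℝ) :
    (w₁ s * w₂ s * w₃ s).im = (w₁ t * w₂ t * w₃ t).im := by
  -- The derivative of `w₁ w₂ w₃` is a signed sum of the `|wᵢ wⱼ|²`, hence real.
  have hd : ∀ r, HasDerivAt (fun r => (w₁ r * w₂ r * w₃ r).im) 0 r := fun r => by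
    have := Complex.imCLM.hasFDerivAt.comp_hasDerivAt r
      (((h.deriv₁ r trivial).mul (h.deriv₂ r trivial)).mul (h.deriv₃ r trivial))
    refine this.congr_deriv ?_
    simp
    ring
  exact is_const_of_deriv_eq_zero (fun r => (hd r).differentiableAt) (fun r => (hd r).deriv) s t

theorem SolvesOn.norm_sq_eq (h : SolvesOn univ w₁ w₂ w₃) (t : ℝ) :
    ‖w₂ t‖ ^ 2 = ‖w₁ 0‖ ^ 2 + ‖w₂ 0‖ ^ 2 - ‖w₁ t‖ ^ 2 ∧
      ‖w₃ t‖ ^ 2 = ‖w₁ 0‖ ^ 2 + ‖w₃ 0‖ ^ 2 - ‖w₁ t‖ ^ 2 := by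
  have e₁ := norm_sq_add_conserved (c := fun _ => 1) isOpen_univ isPreconnected_univ
    (fun t ht => by simpa using h.deriv₁ t ht) (fun t ht => by simpa using h.deriv₂ t ht)
    (mem_univ t) (mem_univ 0)
  have e₂ := norm_sq_add_conserved (c := fun _ => 1) (w₃ := w₂) isOpen_univ isPreconnected_univ
    (fun t ht => by simpa [mul_comm] using h.deriv₁ t ht)
    (fun t ht => by simpa [mul_comm] using h.deriv₃ t ht) (mem_univ t) (mem_univ 0)
  exact ⟨by linarith, by linarith⟩

end Solutions

/-! ### Second-order equations for the rescaled Jacobi functions -/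

section ScaledJacobi

variable {k : ℝ} (A m s : ℝ)

theorem HasDerivAt.const_mul_comp_const_mul {f : ℝ → ℝ} {f' : ℝ} {A m s : ℝ}
    (h : HasDerivAt f f' (m * s)) : HasDerivAt (fun s => A * f (m * s)) (A * m * f') s :=
  ((h.comp s ((hasDerivAt_id s).const_mul m)).const_mul A).congr_deriv (by ring)

theorem hasDerivAt_scaled_jacobiSn (hk : k ^ 2 < 1) :
    HasDerivAt (fun s => A * jacobiSn (m * s) k)
      (A * m * (jacobiCn (m * s) k * jacobiDn (m * s) k)) s :=
  (hasDerivAt_jacobiSn hk (m * s)).const_mul_comp_const_mul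

theorem hasDerivAt_scaled_jacobiCn (hk : k ^ 2 < 1) :
    HasDerivAt (fun s => A * jacobiCn (m * s) k)
      (A * m * -(jacobiSn (m * s) k * jacobiDn (m * s) k)) s :=
  (hasDerivAt_jacobiCn hk (m * s)).const_mul_comp_const_mul

theorem hasDerivAt_scaled_jacobiDn (hk : k ^ 2 < 1) :
    HasDerivAt (fun s => A * jacobiDn (m * s) k)
      (A * m * -(k ^ 2 * (jacobiSn (m * s) k * jacobiCn (m * s) k))) s :=
  (hasDerivAt_jacobiDn hk (m * s)).const_mul_comp_const_mul

theorem second_deriv_scaled_jacobiSn (hk : k ^ 2 < 1) :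
    HasDerivAt (fun s => A * m * (jacobiCn (m * s) k * jacobiDn (m * s) k))
      (-m ^ 2 * (1 + k ^ 2 - 2 * k ^ 2 * jacobiSn (m * s) k ^ 2) *
        (A * jacobiSn (m * s) k)) s := by
  refine ((hasDerivAt_jacobiCn hk (m * s)).mul
    (hasDerivAt_jacobiDn hk (m * s))).const_mul_comp_const_mul.congr_deriv ?_
  linear_combination (-A * m ^ 2 * jacobiSn (m * s) k) * jacobiDn_sq hk (m * s) -
    A * m ^ 2 * jacobiSn (m * s) k * k ^ 2 * jacobiCn_sq (k := k) (m * s)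

theorem second_deriv_scaled_jacobiCn (hk : k ^ 2 < 1) :
    HasDerivAt (fun s => A * m * -(jacobiSn (m * s) k * jacobiDn (m * s) k))
      (-m ^ 2 * (1 - 2 * k ^ 2 * jacobiSn (m * s) k ^ 2) * (A * jacobiCn (m * s) k)) s := by
  refine ((hasDerivAt_jacobiSn hk (m * s)).mul
    (hasDerivAt_jacobiDn hk (m * s))).neg.const_mul_comp_const_mul.congr_deriv ?_
  linear_combination (-A * m ^ 2 * jacobiCn (m * s) k) * jacobiDn_sq hk (m * s)

theorem second_deriv_scaled_jacobiDn (hk : k ^ 2 < 1) :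
    HasDerivAt (fun s => A * m * -(k ^ 2 * (jacobiSn (m * s) k * jacobiCn (m * s) k)))
      (-m ^ 2 * k ^ 2 * (1 - 2 * jacobiSn (m * s) k ^ 2) * (A * jacobiDn (m * s) k)) s := by
  refine (((hasDerivAt_jacobiSn hk (m * s)).mul
    (hasDerivAt_jacobiCn hk (m * s))).const_mul
      (k ^ 2)).neg.const_mul_comp_const_mul.congr_deriv ?_
  linear_combination (-A * m ^ 2 * k ^ 2 * jacobiDn (m * s) k) * jacobiCn_sq (k := k) (m * s)

end ScaledJacobi

/-! ### The main theorem -/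

theorem theorem6p6
    (ε : ℝ) (hε : 0 < ε) (w₁ w₂ w₃ : ℝ → ℂ)
    (hne : ∀ t ∈ Set.Ioo (-ε) ε, w₁ t ≠ 0 ∧ w₂ t ≠ 0 ∧ w₃ t ≠ 0)
    (hode : SolvesOn (Set.Ioo (-ε) ε) w₁ w₂ w₃)
    (α₁ α₂ α₃ : ℝ) (u : ℝ → ℝ)
    (hu : ∀ t ∈ Set.Ioo (-ε) ε,
      ‖w₁ t‖ ^ 2 = α₁ + u t ∧ ‖w₂ t‖ ^ 2 = α₂ - u t ∧ ‖w₃ t‖ ^ 2 = α₃ - u t)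
    (hα : α₂ ≤ α₃) :
    -- the solution extends to the whole line
    (∃ W₁ W₂ W₃ : ℝ → ℂ, SolvesOn Set.univ W₁ W₂ W₃ ∧
      Set.EqOn W₁ w₁ (Set.Ioo (-ε) ε) ∧ Set.EqOn W₂ w₂ (Set.Ioo (-ε) ε) ∧
      Set.EqOn W₃ w₃ (Set.Ioo (-ε) ε)) ∧
    -- and, for every such extension, the map `Φ` has the asserted properties
    ∀ W₁ W₂ W₃ : ℝ → ℂ, SolvesOn Set.univ W₁ W₂ W₃ →
      Set.EqOn W₁ w₁ (Set.Ioo (-ε) ε) → Set.EqOn W₂ w₂ (Set.Ioo (-ε) ε) →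
      Set.EqOn W₃ w₃ (Set.Ioo (-ε) ε) →
      (∀ p, jacobiMap α₁ α₂ α₃ W₁ W₂ W₃ p ∈ Metric.sphere (0 : EuclideanSpace ℂ (Fin 3)) 1) ∧
      IsHarmonicMapToSphere (jacobiMap α₁ α₂ α₃ W₁ W₂ W₃) ∧
      IsWeaklyConformal (jacobiMap α₁ α₂ α₃ W₁ W₂ W₃) ∧
      (∀ p : EuclideanSpace ℝ (Fin 2), W₁ (p 1) ≠ 0 → W₂ (p 1) ≠ 0 → W₃ (p 1) ≠ 0 →
        ConformalAt (jacobiMap α₁ α₂ α₃ W₁ W₂ W₃) p) ∧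
      ((w₁ 0 * w₂ 0 * w₃ 0).im ≠ 0 → Conformal (jacobiMap α₁ α₂ α₃ W₁ W₂ W₃)) := by
  refine ⟨hode.extend hε, fun W₁ W₂ W₃ hW h₁ h₂ h₃ => ?_⟩
  have h0 : (0 : ℝ) ∈ Ioo (-ε) ε := ⟨by linarith, hε⟩
  obtain ⟨hu₁, hu₂, hu₃⟩ := hu 0 h0
  have hpos₁ : 0 < ‖w₁ 0‖ ^ 2 := by have := norm_pos_iff.2 (hne 0 h0).1; positivity
  have hP : 0 < α₁ + α₂ := by nlinarith [sq_nonneg ‖w₂ 0‖]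
  have hQ : 0 < α₁ + α₃ := by linarith
  -- the squared norms of the extended solution
  have hn₂ : ∀ t, ‖W₂ t‖ ^ 2 = α₁ + α₂ - ‖W₁ t‖ ^ 2 := fun t => by
    rw [(hW.norm_sq_eq t).1, h₁ h0, h₂ h0, hu₁, hu₂]; ring
  have hn₃ : ∀ t, ‖W₃ t‖ ^ 2 = α₁ + α₃ - ‖W₁ t‖ ^ 2 := fun t => by
    rw [(hW.norm_sq_eq t).2, h₁ h0, h₃ h0, hu₁, hu₃]; ring
  -- the constants
  set A : ℝ := (√(α₁ + α₂))⁻¹ with hA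
  set C : ℝ := (√(α₁ + α₃))⁻¹ with hC
  set m : ℝ := √(α₁ + α₃) with hm
  set k : ℝ := √((α₃ - α₂) / (α₁ + α₃)) with hk
  have hApos : 0 < A := inv_pos.2 (Real.sqrt_pos.2 hP)
  have hmpos : 0 < m := Real.sqrt_pos.2 hQ
  have hCpos : 0 < C := inv_pos.2 hmpos
  have hA2 : A ^ 2 = 1 / (α₁ + α₂) := by rw [hA, inv_pow, Real.sq_sqrt hP.le, one_div]
  have hm2 : m ^ 2 = α₁ + α₃ := Real.sq_sqrt hQ.le
  have hC2 : C ^ 2 = 1 / (α₁ + α₃) := by rw [hC, inv_pow, hm2, one_div]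
  have hk2 : k ^ 2 = (α₃ - α₂) / (α₁ + α₃) := Real.sq_sqrt (div_nonneg (by linarith) hQ.le)
  -- Here `1 - k² = (α₁ + α₂) / (α₁ + α₃)` is positive, so the degenerate modulus `k = 1` does not
  -- occur.
  have hk1 : k ^ 2 < 1 := by rw [hk2, div_lt_one hQ]; linarith
  have hmap : jacobiMap α₁ α₂ α₃ W₁ W₂ W₃ = fun p : EuclideanSpace ℝ (Fin 2) =>
      weightedVec (A * jacobiDn (m * p 0) k) (A * jacobiCn (m * p 0) k)
        (C * jacobiSn (m * p 0) k) (W₁ (p 1)) (W₂ (p 1)) (W₃ (p 1)) := rfl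
  rw [hmap]
  have hsphere : ∀ p : EuclideanSpace ℝ (Fin 2),
      weightedVec (A * jacobiDn (m * p 0) k) (A * jacobiCn (m * p 0) k)
        (C * jacobiSn (m * p 0) k) (W₁ (p 1)) (W₂ (p 1)) (W₃ (p 1)) ∈
        sphere (0 : EuclideanSpace ℂ (Fin 3)) 1 := fun p => by
    rw [mem_sphere_zero_iff_norm, ← sq_eq_sq₀ (norm_nonneg _) zero_le_one,
      ← real_inner_self_eq_norm_sq, inner_self_weightedVec, hn₂, hn₃, mul_pow, mul_pow, mul_pow,
      jacobiDn_sq hk1, jacobiCn_sq, hA2, hC2, hk2]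
    field_simp
    ring
  have hharm : IsHarmonicMapToSphere fun p : EuclideanSpace ℝ (Fin 2) =>
      weightedVec (A * jacobiDn (m * p 0) k) (A * jacobiCn (m * p 0) k)
        (C * jacobiSn (m * p 0) k) (W₁ (p 1)) (W₂ (p 1)) (W₃ (p 1)) := by
    refine ⟨?_, hsphere, fun p => ?_⟩
    · have hsm : ∀ {f : ℝ → ℝ} (B : ℝ), ContDiff ℝ ∞ f → ContDiff ℝ ∞ fun s => B * f (m * s) :=
        fun B hf => contDiff_const.mul (hf.comp (by fun_prop))
      exact contDiff_weightedVec (hsm A (contDiff_jacobiDn hk1)) (hsm A (contDiff_jacobiCn hk1))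
        (hsm C (contDiff_jacobiSn hk1)) hW.contDiff.1 hW.contDiff.2.1 hW.contDiff.2.2
    · rw [sphereTension_weightedVec (fun s => hasDerivAt_scaled_jacobiDn A m s hk1)
        (fun s => hasDerivAt_scaled_jacobiCn A m s hk1)
        (fun s => hasDerivAt_scaled_jacobiSn C m s hk1)
        (fun s => second_deriv_scaled_jacobiDn A m s hk1)
        (fun s => second_deriv_scaled_jacobiCn A m s hk1)
        (fun s => second_deriv_scaled_jacobiSn C m s hk1)
        (fun t => hW.deriv₁ t trivial) (fun t => hW.deriv₂ t trivial)
        (fun t => hW.deriv₃ t trivial) hW.second_deriv₁ hW.second_deriv₂ hW.second_deriv₃,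
        -- `l` is read off from the first coordinate, `-m² k² (1 - 2 sn²) - (|W₂|² + |W₃|²)`; the
        -- remaining goals check that all three coordinates give it.
        weightedVec_add_of_eigen rfl rfl rfl rfl rfl rfl
          (l := 2 * (‖W₁ (p 1)‖ ^ 2 - α₁) - 2 * α₃ +
            2 * (α₃ - α₂) * jacobiSn (m * p 0) k ^ 2)]
      · exact starProjection_orthogonal_span_smul _ _
      all_goals
        simp only [hn₂, hn₃, hm2, hk2]
        field_simp
        ring
  have hder := fun p : EuclideanSpace ℝ (Fin 2) => hasFDerivAt_weightedVec (p := p)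
    (hasDerivAt_scaled_jacobiDn A m _ hk1) (hasDerivAt_scaled_jacobiCn A m _ hk1)
    (hasDerivAt_scaled_jacobiSn C m _ hk1) (hW.deriv₁ _ trivial) (hW.deriv₂ _ trivial)
    (hW.deriv₃ _ trivial)
  have hconf := fun p : EuclideanSpace ℝ (Fin 2) =>
    inner_fderiv_of_orthogonal_partials (hder p)
    (by
      have e₁ : (starRingEnd ℂ (W₁ (p 1)) * starRingEnd ℂ (W₂ (p 1) * W₃ (p 1))).re =
          (W₁ (p 1) * W₂ (p 1) * W₃ (p 1)).re := by
        rw [← map_mul, Complex.conj_re, mul_assoc]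
      have e₂ : (starRingEnd ℂ (W₂ (p 1)) * -starRingEnd ℂ (W₃ (p 1) * W₁ (p 1))).re =
          -(W₁ (p 1) * W₂ (p 1) * W₃ (p 1)).re := by
        rw [mul_neg, ← map_mul, Complex.neg_re, Complex.conj_re]; ring_nf
      have e₃ : (starRingEnd ℂ (W₃ (p 1)) * -starRingEnd ℂ (W₁ (p 1) * W₂ (p 1))).re =
          -(W₁ (p 1) * W₂ (p 1) * W₃ (p 1)).re := by
        rw [mul_neg, ← map_mul, Complex.neg_re, Complex.conj_re]; ring_nf
      -- The inner product of the partials is `m sn cn dn Re (W₁ W₂ W₃)` times `A² (1 - k²) - C²`.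
      have e : A ^ 2 * (1 - k ^ 2) = C ^ 2 := by
        rw [hA2, hC2, hk2]
        field_simp
        ring
      rw [inner_weightedVec, e₁, e₂, e₃]
      linear_combination m * jacobiSn (m * p 0) k * jacobiCn (m * p 0) k *
        jacobiDn (m * p 0) k * (W₁ (p 1) * W₂ (p 1) * W₃ (p 1)).re * e)
    (by
      rw [inner_self_weightedVec, inner_self_weightedVec]
      simp only [RCLike.norm_conj, norm_neg, norm_mul, mul_pow, neg_sq, hn₂, hn₃,
        jacobiDn_sq hk1, jacobiCn_sq, hA2, hC2, hk2, hm2]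
      field_simp
      ring)
  have hconfAt : ∀ p : EuclideanSpace ℝ (Fin 2), W₁ (p 1) ≠ 0 → W₂ (p 1) ≠ 0 → W₃ (p 1) ≠ 0 →
      ConformalAt (fun p : EuclideanSpace ℝ (Fin 2) =>
        weightedVec (A * jacobiDn (m * p 0) k) (A * jacobiCn (m * p 0) k)
          (C * jacobiSn (m * p 0) k) (W₁ (p 1)) (W₂ (p 1)) (W₃ (p 1))) p := by
    intro p _ hne₂ hne₃
    refine conformalAt_iff'.2 ⟨_, ?_, hconf p⟩
    have hd := jacobiDn_pos hk1 (m * p 0)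
    have n₂ := norm_pos_iff.2 hne₂
    have n₃ := norm_pos_iff.2 hne₃
    rw [inner_self_weightedVec]
    -- The conformal factor is `|∂ₛΦ|²`. Since `sn` and `cn` have no common zero and `dn > 0`, its
    -- `W₂` term or its `W₃` term is positive.
    rcases eq_or_ne (jacobiSn (m * p 0) k) 0 with hs | hs
    · have hc : jacobiCn (m * p 0) k ≠ 0 := fun hc => by
        have := jacobiCn_sq (k := k) (m * p 0)
        rw [hs, hc] at this
        norm_num at this
      have : 0 < (C * m * (jacobiCn (m * p 0) k * jacobiDn (m * p 0) k)) ^ 2 :=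
        sq_pos_of_ne_zero (mul_ne_zero (mul_pos hCpos hmpos).ne' (mul_ne_zero hc hd.ne'))
      positivity
    · have : 0 < (A * m * -(jacobiSn (m * p 0) k * jacobiDn (m * p 0) k)) ^ 2 :=
        sq_pos_of_ne_zero
          (mul_ne_zero (mul_pos hApos hmpos).ne' (neg_ne_zero.2 (mul_ne_zero hs hd.ne')))
      positivity
  refine ⟨hsphere, hharm, ⟨fun p => (hder p).differentiableAt,
    fun p => ⟨_, real_inner_self_nonneg, hconf p⟩⟩, hconfAt, fun him p => ?_⟩
  have him' : (W₁ (p 1) * W₂ (p 1) * W₃ (p 1)).im ≠ 0 := by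
    rwa [hW.im_mul_eq _ 0, h₁ h0, h₂ h0, h₃ h0]
  refine hconfAt p ?_ ?_ ?_ <;> intro hz <;> simp [hz] at him'
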